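/- Let $X$ be a connected, locally path connected topological space, $x_0\in X$, and write $\alpha*\beta$ for "first $\alpha$, then $\beta$". For a subgroup $H\le\pi_1(X,x_0)$ and paths $\alpha,\gamma$ in $X$ from $x_0$ to a common endpoint write $[\alpha]_H=[\gamma]_H$ if $[\alpha*\gamma^{-1}]\in H$. The space $X$ is called strong $H$-SLT (small loop transfer) at $x_0$ if for every $x\in X$ and every open neighbourhood $U$ of $x_0$ there is an open neighbourhood $V$ of $x$ such that for every loop $\beta$ in $V$ based at $x$ and every path $\alpha$ in $X$ from $x_0$ to $x$ there is a loop $\lambda$ in $U$ based at $x_0$ with $[\alpha*\beta*\alpha^{-1}]_H=[\lambda]_H$. It is called strong SLT at $x_0$ if this holds for the trivial subgroup $H=1$. A semicovering map is a local homeomorphism $p:\widetilde X\to X$ with continuous lifting of paths and homotopies, i.e. such that for every $\tilde x\in\widetilde X$ composition with $p$ gives homeomorphisms (for the compact-open topologies) from the space of paths in $\widetilde X$ starting at $\tilde x$ onto the space of paths in $X$ starting at $p(\tilde x)$, and from the space of maps $([0,1]^2,(0,0))\to(\widetilde X,\tilde x)$ onto the space of maps $([0,1]^2,(0,0))\to(X,p(\tilde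 x))$. Let $p:\widetilde X\to X$ be a semicovering map with $\widetilde X$ connected (and non-empty). 1. If $\tilde x_0\in p^{-1}(x_0)$, $H=p_*\pi_1(\widetilde X,\tilde x_0)\le\pi_1(X,x_0)$, and $X$ is strong $H$-SLT at $x_0$, then $p$ is a (surjective) covering map. 2. In particular, if $X$ is strong SLT at $x_0$, then $p$ is a (surjective) covering map. -/

import Mathlib

open scoped unitInterval

section Semicovering

variable {E X : Type*} [TopologicalSpace E] [TopologicalSpace X]

/-- The space `(PX)_x` of paths in `X` starting at `x`, with the compact-open topology. -/
abbrev PathsFrom (X : Type*) [TopologicalSpace X] (x : X) : Type _ :=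
  {γ : C(I, X) // γ 0 = x}

/-- The space `(ΦX)_x` of maps `I × I → X` sending the corner `(0, 0)` to `x`, with the
compact-open topology. The pair `(I × I, (0, 0))` is homeomorphic to the closed disc with a base
point on its boundary circle. -/
abbrev SquaresFrom (X : Type*) [TopologicalSpace X] (x : X) : Type _ :=
  {Γ : C(I × I, X) // Γ (0, 0) = x}

/-- Composition with `p`, as a map `(PE)_e → (PX)_{p e}`. -/
def PathsFrom.map (p : C(E, X)) (e : E) (γ : PathsFrom E e) : PathsFrom X (p e) :=
  ⟨p.comp γ.1, congrArg p γ.2⟩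

/-- Composition with `p`, as a map `(ΦE)_e → (ΦX)_{p e}`. -/
def SquaresFrom.map (p : C(E, X)) (e : E) (Γ : SquaresFrom E e) : SquaresFrom X (p e) :=
  ⟨p.comp Γ.1, congrArg p Γ.2⟩

/-- A semicovering map: a local homeomorphism with continuous lifting of paths and of
homotopies. -/
structure IsSemicoveringMap (p : C(E, X)) : Prop where
  isLocalHomeomorph : IsLocalHomeomorph p
  continuous_path_lifting : ∀ e : E, IsHomeomorph (PathsFrom.map p e)
  continuous_homotopy_lifting : ∀ e : E, IsHomeomorph (SquaresFrom.map p e)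

end Semicovering

section StrongSLT

variable {X : Type*} [TopologicalSpace X] {x₀ : X}

/-- `[α]_H = [γ]_H` for paths `α`, `γ` from `x₀` to the same point: the class of the loop
"`α` followed by the reverse of `γ`" lies in `H`. -/
def Path.EqMod (H : Subgroup (FundamentalGroup X x₀)) {x : X} (α γ : Path x₀ x) : Prop :=
  FundamentalGroup.fromPath (Path.Homotopic.Quotient.mk (α.trans γ.symm)) ∈ H

/-- `X` is a strong `H`-small loop transfer space at `x₀`. -/
def IsStrongRelSLTAt (X : Type*) [TopologicalSpace X] (x₀ : X)
    (H : Subgroup (FundamentalGroup X x₀)) : Prop :=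
  ∀ x : X, ∀ U : Set X, IsOpen U → x₀ ∈ U →
    ∃ V : Set X, IsOpen V ∧ x ∈ V ∧
      ∀ β : Path x x, (∀ t, β t ∈ V) → ∀ α : Path x₀ x,
        ∃ l : Path x₀ x₀, (∀ t, l t ∈ U) ∧ Path.EqMod H ((α.trans β).trans α.symm) l

/-- `X` is a strong small loop transfer space at `x₀`: the case of the trivial subgroup. -/
def IsStrongSLTAt (X : Type*) [TopologicalSpace X] (x₀ : X) : Prop :=
  IsStrongRelSLTAt X x₀ ⊥

end StrongSLT

/-!
A semicovering has unique lifts of paths and lifts of squares, so the endpoint of a lifted path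
depends only on the homotopy class of the path (`IsSemicoveringMap.endpoint_eq`).

Let `e₀` lie over `x₀`, let `H` be the image of `π₁(E, e₀)`, and let `U` be the image of an open set
around `e₀` on which `p` is invertible. Loops in `U` at `x₀` then lift to loops at `e₀`. The strong
`H`-SLT property for `U` and a point `x` yields a neighbourhood `V` of `x`, the same for all paths
`α` from `x₀` to `x`, such that `α * β * α⁻¹` equals a loop in `U` modulo `H` whenever `β` is a loop
in `V` at `x`. So `α * β * α⁻¹` lifts to a loop at `e₀`, and since `α` may be taken to be the image
of a path from `e₀` to any prescribed point of the fibre, every lift of `β` is a loop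
(`IsSemicoveringMap.exists_loops_lift_to_loops`). Shrinking `V`, one may assume it path connected;
then each path component of `p ⁻¹' V` is open, meets the fibre over `x` exactly once and is mapped
bijectively onto `V`, so `V` is evenly covered (`IsSemicoveringMap.isEvenlyCovered`).
-/

section Lifting

variable {E X : Type*} [TopologicalSpace E] [TopologicalSpace X] {p : C(E, X)}

/-- The domain of a local homeomorphism is modelled on its codomain. -/
theorem IsLocalHomeomorph.locallyPathConnectedSpace [LocallyPathConnectedSpace X] {f : E → X}
    (hf : IsLocalHomeomorph f) : LocallyPathConnectedSpace E := by
  choose φ hφ _ using hf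
  let : ChartedSpace X E :=
    { atlas := Set.range φ
      chartAt := φ
      mem_chart_source := hφ
      chart_mem_atlas := fun e ↦ ⟨e, rfl⟩ }
  exact ChartedSpace.locallyPathConnectedSpace X E

namespace IsSemicoveringMap

theorem exists_path_lift (hp : IsSemicoveringMap p) {a b : X} (γ : Path a b) {e : E}
    (he : p e = a) : ∃ e' : E, p e' = b ∧ ∃ Γ : Path e e', ∀ t, p (Γ t) = γ t := by
  obtain ⟨⟨Γ, hΓ⟩, h⟩ := (hp.continuous_path_lifting e).surjective
    ⟨γ.toContinuousMap, by simp [he]⟩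
  have h' (t : I) : p (Γ t) = γ t := DFunLike.congr_fun (congrArg Subtype.val h) t
  exact ⟨Γ 1, by simp [h'], ⟨Γ, hΓ, rfl⟩, h'⟩

theorem path_lift_unique (hp : IsSemicoveringMap p) {Γ Δ : C(I, E)} (h0 : Γ 0 = Δ 0)
    (h : ∀ t, p (Γ t) = p (Δ t)) : Γ = Δ :=
  congrArg Subtype.val <| (hp.continuous_path_lifting (Δ 0)).injective
    (a₁ := ⟨Γ, h0⟩) (a₂ := ⟨Δ, rfl⟩) (Subtype.ext (ContinuousMap.ext h))

/-- Lifts of homotopic paths with the same starting point have the same endpoint. -/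
theorem endpoint_eq (hp : IsSemicoveringMap p) {a b : X} {γ δ : Path a b} (hγδ : γ.Homotopic δ)
    {e e₁ e₂ : E} (Γ : Path e e₁) (Δ : Path e e₂) (hΓ : ∀ t, p (Γ t) = γ t)
    (hΔ : ∀ t, p (Δ t) = δ t) : e₁ = e₂ := by
  obtain ⟨F⟩ := hγδ
  have he : p e = a := by simpa using hΓ 0
  obtain ⟨⟨G, hG⟩, h⟩ := (hp.continuous_homotopy_lifting e).surjective
    ⟨F.toContinuousMap, by simp [he]⟩
  have hGF (s : I × I) : p (G s) = F s := DFunLike.congr_fun (congrArg Subtype.val h) s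
  -- The edge `t = 0` of the lifted square lies over a constant path, hence is constant.
  have left (s : I) : G (s, 0) = e := by
    have := hp.path_lift_unique (Γ := G.comp ⟨fun s ↦ (s, 0), by fun_prop⟩)
      (Δ := .const I e) (by simpa using hG) (by simp [hGF, he])
    exact DFunLike.congr_fun this s
  have bottom : G (0, 1) = e₁ := by
    have := hp.path_lift_unique (Γ := G.comp ⟨fun t ↦ (0, t), by fun_prop⟩)
      (Δ := Γ.toContinuousMap) (by simp [left]) (by simp [hGF, hΓ])
    simpa using DFunLike.congr_fun this 1
  have top : G (1, 1) = e₂ := by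
    have := hp.path_lift_unique (Γ := G.comp ⟨fun t ↦ (1, t), by fun_prop⟩)
      (Δ := Δ.toContinuousMap) (by simp [left]) (by simp [hGF, hΔ])
    simpa using DFunLike.congr_fun this 1
  -- So is the edge `t = 1`, which joins the two endpoints.
  have right : G (1, 1) = G (0, 1) := by
    have := hp.path_lift_unique (Γ := G.comp ⟨fun s ↦ (s, 1), by fun_prop⟩)
      (Δ := .const I (G (0, 1))) (by simp) (by simp [hGF])
    simpa using DFunLike.congr_fun this 1
  rw [← bottom, ← top, right]

theorem surjective [Nonempty E] [PathConnectedSpace X] (hp : IsSemicoveringMap p) :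
    Function.Surjective p := fun y ↦
  have ⟨e⟩ := ‹Nonempty E›
  have ⟨e', he', _⟩ := hp.exists_path_lift (PathConnectedSpace.somePath (p e) y) rfl
  ⟨e', he'⟩

/-- `V` depends only on `x`, not on the point of the fibre over `x` at which the lift starts. -/
theorem exists_loops_lift_to_loops [PathConnectedSpace E] (hp : IsSemicoveringMap p) {x₀ : X}
    {e₀ : E} (he₀ : p e₀ = x₀)
    (h : IsStrongRelSLTAt X x₀ (FundamentalGroup.mapOfEq p he₀).range) (x : X) :
    ∃ V : Set X, IsOpen V ∧ x ∈ V ∧ ∀ β : Path x x, (∀ t, β t ∈ V) →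
      ∀ (e e' : E) (Γ : Path e e'), (∀ t, p (Γ t) = β t) → e' = e := by
  obtain ⟨φ, hφ, hφp⟩ := hp.isLocalHomeomorph e₀
  obtain ⟨V, hV, hxV, hVloop⟩ := h x φ.target φ.open_target (by
    rw [← he₀, hφp]; exact φ.map_source hφ)
  refine ⟨V, hV, hxV, fun β hβ e e' Γ hΓ ↦ ?_⟩
  have he : p e = x := by simpa using hΓ 0
  have he' : p e' = x := by simpa using hΓ 1
  let A : Path e₀ e := PathConnectedSpace.somePath e₀ e
  let α : Path x₀ x := (A.map p.continuous).cast he₀.symm he.symm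
  obtain ⟨l, hlU, k, hk⟩ := hVloop β hβ α
  obtain ⟨K, rfl⟩ := Path.Homotopic.Quotient.mk_surjective k
  have hφx₀ : φ.symm x₀ = e₀ := by rw [← he₀, hφp, φ.left_inv hφ]
  let L : Path e₀ e₀ :=
    { toFun := fun t ↦ φ.symm (l t)
      continuous_toFun := φ.continuousOn_symm.comp_continuous l.continuous hlU
      source' := by simpa using hφx₀
      target' := by simpa using hφx₀ }
  have hL (t : I) : p (L t) = l t := by
    rw [hφp]; exact φ.right_inv (hlU t)
  have hK : ((K.map p.continuous).cast he₀.symm he₀.symm).Homotopic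
      (((α.trans β).trans α.symm).trans l.symm) := by
    rw [← Path.Homotopic.Quotient.eq]
    rw [FundamentalGroup.mapOfEq_apply] at hk
    exact hk
  -- `K * L * A` and `A * Γ` lift homotopic paths, and they end at `e` and `e'`.
  refine (hp.endpoint_eq
    (γ := (((K.map p.continuous).cast he₀.symm he₀.symm).trans l).trans α) (δ := α.trans β)
    ?_ ((K.trans L).trans A) (A.trans Γ) ?_ ?_).symm
  · rw [← Path.Homotopic.Quotient.eq] at hK ⊢
    simp only [Path.Homotopic.Quotient.mk_trans, Path.Homotopic.Quotient.mk_symm] at hK ⊢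
    rw [hK]
    simp [Path.Homotopic.Quotient.trans_assoc]
  · intro t
    simp only [Path.trans_apply]
    split_ifs <;> simp [hL, α]
  · intro t
    simp only [Path.trans_apply]
    split_ifs <;> simp [hΓ, α]

/-- The sheets over `V` are the path components in `p ⁻¹' V` of the points over `x`. -/
theorem isEvenlyCovered [LocallyPathConnectedSpace X] (hp : IsSemicoveringMap p) {x : X}
    {V : Set X} (hV : IsOpen V) (hVconn : ∀ y ∈ V, JoinedIn V x y) (hxV : x ∈ V)
    (hxp : (p ⁻¹' {x}).Nonempty)
    (hloop : ∀ β : Path x x, (∀ t, β t ∈ V) →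
      ∀ (e e' : E) (Γ : Path e e'), (∀ t, p (Γ t) = β t) → e' = e) :
    IsEvenlyCovered p x (p ⁻¹' {x}) := by
  have := hp.isLocalHomeomorph.locallyPathConnectedSpace
  have : DiscreteTopology (p ⁻¹' {x}) :=
    (IsDiscrete.of_openPartialHomeomorph p subset_rfl fun e _ ↦
      have ⟨φ, hφ, h⟩ := hp.isLocalHomeomorph e
      ⟨φ, hφ, h.symm⟩).1
  have : Nonempty (p ⁻¹' {x}) := hxp.to_subtype
  have : Nonempty (X → E) := ⟨fun _ ↦ hxp.some⟩
  let S (e : p ⁻¹' {x}) : Set E := pathComponentIn (p ⁻¹' V) e.1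
  have hSopen (e) : IsOpen (S e) := (hV.preimage p.continuous).pathComponentIn _
  have hSsurj (e) : (S e).SurjOn p V := fun y hy ↦ by
    obtain ⟨γ, hγ⟩ := hVconn y hy
    obtain ⟨e', he', Γ, hΓ⟩ := hp.exists_path_lift γ e.2
    exact ⟨e', ⟨Γ, fun t ↦ by simp [hΓ, hγ]⟩, he'⟩
  have hSinj (e) : (S e).InjOn p := by
    rintro e₁ ⟨Γ₁, h₁⟩ e₂ ⟨Γ₂, h₂⟩ he
    have hex : p e.1 = x := e.2
    let γ₁ : Path x (p e₁) := (Γ₁.map p.continuous).cast hex.symm rfl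
    let γ₂ : Path x (p e₁) := (Γ₂.map p.continuous).cast hex.symm he
    -- The lift `Δ` of `γ₂⁻¹` from `e₁` closes `Γ₁` up to a lift of a loop, so it ends at `e`;
    -- then `Δ⁻¹` and `Γ₂` are lifts of `γ₂` with the same starting point.
    obtain ⟨f, -, Δ, hΔ⟩ := hp.exists_path_lift γ₂.symm (rfl : p e₁ = p e₁)
    have hf : f = e.1 := by
      refine hloop (γ₁.trans γ₂.symm) (fun t ↦ ?_) _ _ (Γ₁.trans Δ) fun t ↦ ?_
      · simp only [Path.trans_apply]
        split_ifs
        · exact h₁ _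
        · exact h₂ _
      · simp only [Path.trans_apply]
        split_ifs
        · rfl
        · exact hΔ _
    subst hf
    exact hp.endpoint_eq (.refl γ₂) Δ.symm Γ₂ (fun t ↦ by simp [hΔ]) (fun t ↦ rfl)
  refine .of_trivialization (t := hV.trivializationDiscrete (f := p) S V
    (fun e W hW ↦ ⟨fun h ↦ (h.preimage p.continuous).inter (hSopen e), fun h ↦ ?_⟩)
    hSinj hSsurj (fun e₁ e₂ hne ↦ ?_) fun e he ↦ ?_) hxV
  · convert hp.isLocalHomeomorph.isOpenMap _ h
    refine subset_antisymm (fun y hy ↦ ?_) ?_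
    · obtain ⟨e', he', rfl⟩ := hSsurj e (hW hy)
      exact ⟨e', ⟨hy, he'⟩, rfl⟩
    · rintro _ ⟨e', he', rfl⟩
      exact he'.1
  · refine Set.disjoint_left.mpr fun e h₁ h₂ ↦ hne (Subtype.ext ?_)
    obtain ⟨Γ, hΓ⟩ := JoinedIn.trans h₁ (JoinedIn.symm h₂)
    exact (hloop ((Γ.map p.continuous).cast (e₁.2 : p e₁ = x).symm (e₂.2 : p e₂ = x).symm) hΓ
      _ _ Γ fun t ↦ rfl).symm
  · obtain ⟨γ, hγ⟩ := (hVconn _ he).symm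
    obtain ⟨e', he', Γ, hΓ⟩ := hp.exists_path_lift γ rfl
    exact Set.mem_iUnion.mpr ⟨⟨e', he'⟩, Γ.symm, fun t ↦ by simp [hΓ, hγ]⟩

theorem isCoveringMap [PathConnectedSpace E] [PathConnectedSpace X] [LocallyPathConnectedSpace X]
    (hp : IsSemicoveringMap p) {x₀ : X} {e₀ : E} (he₀ : p e₀ = x₀)
    (h : IsStrongRelSLTAt X x₀ (FundamentalGroup.mapOfEq p he₀).range) : IsCoveringMap p := by
  intro x
  obtain ⟨V, hV, hxV, hloop⟩ := hp.exists_loops_lift_to_loops he₀ h x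
  exact hp.isEvenlyCovered (V := pathComponentIn V x) (hV.pathComponentIn x)
    (fun y hy ↦ (isPathConnected_pathComponentIn hxV).joinedIn _ (mem_pathComponentIn_self hxV) _ hy)
    (mem_pathComponentIn_self hxV) (hp.surjective x)
    fun β hβ ↦ hloop β fun t ↦ pathComponentIn_subset (hβ t)

end IsSemicoveringMap

theorem IsStrongRelSLTAt.mono {x₀ : X} {H K : Subgroup (FundamentalGroup X x₀)} (hHK : H ≤ K)
    (h : IsStrongRelSLTAt X x₀ H) : IsStrongRelSLTAt X x₀ K := fun x U hU hx₀ ↦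
  have ⟨V, hV, hxV, hloop⟩ := h x U hU hx₀
  ⟨V, hV, hxV, fun β hβ α ↦
    have ⟨l, hl, hlH⟩ := hloop β hβ α
    ⟨l, hl, hHK hlH⟩⟩

end Lifting

theorem corollary2p3 {E X : Type*} [TopologicalSpace E] [ConnectedSpace E]
    [TopologicalSpace X] [ConnectedSpace X] [LocallyPathConnectedSpace X]
    (x₀ : X) (p : C(E, X)) (hp : IsSemicoveringMap p) :
    (∀ (H : Subgroup (FundamentalGroup X x₀)) (e₀ : E) (he₀ : p e₀ = x₀),
        (FundamentalGroup.mapOfEq p he₀).range = H → IsStrongRelSLTAt X x₀ H →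
          IsCoveringMap p ∧ Function.Surjective p) ∧
      (IsStrongSLTAt X x₀ → IsCoveringMap p ∧ Function.Surjective p) := by
  have := hp.isLocalHomeomorph.locallyPathConnectedSpace
  have : PathConnectedSpace E := .of_locallyPathConnectedSpace
  have : PathConnectedSpace X := .of_locallyPathConnectedSpace
  refine ⟨?_, fun h ↦ ?_⟩
  · rintro _ e₀ he₀ rfl h
    exact ⟨hp.isCoveringMap he₀ h, hp.surjective⟩
  · obtain ⟨e₀, he₀⟩ := hp.surjective x₀
    exact ⟨hp.isCoveringMap he₀ (IsStrongRelSLTAt.mono bot_le h), hp.surjective⟩
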